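/- Let $d\ge 1$ and let $\Lambda\subseteq\mathbb R^d$ be a bounded open set (for example a bounded domain with smooth boundary). Let $V:=W_0^{1,2}(\Lambda)\subseteq H:=L^2(\Lambda)\subseteq V^*=W^{-1,2}(\Lambda)$, where $V$ is the closure of $C_c^\infty(\Lambda)$ in $W^{1,2}(\Lambda)$, and put $\|u\|_V:=\big(\int_\Lambda|\nabla u|^2\,dx\big)^{1/2}$. For functions $f_1,\dots,f_d:\mathbb R\to\mathbb R$ let $$A(u)=\Delta u+\sum_{i=1}^d f_i(u)\,D_iu\in V^*,\qquad u\in V,$$ that is, ${}_{V^*}\langle A(u),\varphi\rangle_V=-\int_\Lambda\nabla u\cdot\nabla\varphi\,dx+\sum_{i=1}^d\int_\Lambda f_i(u)\,D_iu\,\varphi\,dx$ for $\varphi\in V$. (1) If $d<3$ and $f_1,\dots,f_d$ are bounded and Lipschitz, then there is a constant $K$ such that $$2\,{}_{V^*}\langle A(u)-A(v),u-v\rangle_V\le-\|u-v\|_V^2+\big(K+K\|v\|_V^2\big)\|u-v\|_H^2,\qquad u,v\in V.$$ (2) If $d=3$ and $f_1,\dots,f_d$ are bounded and Lipschitz, then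 there is a constant $K$ such that $$2\,{}_{V^*}\langle A(u)-A(v),u-v\rangle_V\le-\|u-v\|_V^2+\big(K+K\|v\|_V^4\big)\|u-v\|_H^2,\qquad u,v\in V.$$ (3) If the coefficients do not depend on $u$, i.e. $A(u)=\Delta u+\sum_{i=1}^d f_i\,D_iu$ with $f_i\in L^\infty(\Lambda)$, then for every $d\ge1$ there is a constant $K$ such that $$2\,{}_{V^*}\langle A(u)-A(v),u-v\rangle_V\le-\|u-v\|_V^2+K\|u-v\|_H^2,\qquad u,v\in V.$$ -/

import Mathlib

namespace LocMon

open MeasureTheory TopologicalSpace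
open scoped ENNReal ContDiff Distributions

/-- Euclidean space `ℝ^d`. -/
abbrev E (d : ℕ) : Type := EuclideanSpace ℝ (Fin d)

/-- Lebesgue measure on the open set `Λ`. -/
noncomputable abbrev leb {d : ℕ} (Λ : Opens (E d)) : Measure (E d) :=
  (volume : Measure (E d)).restrict (Λ : Set (E d))

/-- `H = L²(Λ)`. -/
noncomputable abbrev H {d : ℕ} (Λ : Opens (E d)) : Type := Lp ℝ 2 (leb Λ)

/-- `L²(Λ; ℝ^d)`, with norm `(∫_Λ |g|² dx)^{1/2}`. -/
noncomputable abbrev HVec {d : ℕ} (Λ : Opens (E d)) : Type := Lp (E d) 2 (leb Λ)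

/-- `g` is the weak (distributional) gradient of `u` on `Λ`. -/
def HasWeakGrad {d : ℕ} {Λ : Opens (E d)} (u : H Λ) (g : HVec Λ) : Prop :=
  ∀ (φ : 𝓓(Λ, ℝ)) (i : Fin d),
    ∫ x in (Λ : Set (E d)), u x * gradient (φ : E d → ℝ) x i =
      -∫ x in (Λ : Set (E d)), g x i * φ x

theorem continuous_gradient {d : ℕ} {Λ : Opens (E d)} (φ : 𝓓(Λ, ℝ)) :
    Continuous (gradient (φ : E d → ℝ)) :=
  (InnerProductSpace.toDual ℝ (E d)).symm.continuous.comp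
    (φ.contDiff.continuous_fderiv (by simp))

theorem memLp_testFunction {d : ℕ} {Λ : Opens (E d)} (φ : 𝓓(Λ, ℝ)) :
    MemLp (φ : E d → ℝ) 2 (leb Λ) :=
  (φ.continuous.memLp_of_hasCompactSupport φ.hasCompactSupport).restrict _

theorem memLp_gradient {d : ℕ} {Λ : Opens (E d)} (φ : 𝓓(Λ, ℝ)) :
    MemLp (gradient (φ : E d → ℝ)) 2 (leb Λ) := by
  refine ((continuous_gradient φ).memLp_of_hasCompactSupport ?_).restrict _
  exact (φ.hasCompactSupport.fderiv (𝕜 := ℝ)).comp_left (map_zero _)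

theorem gradient_add {d : ℕ} {Λ : Opens (E d)} (φ ψ : 𝓓(Λ, ℝ)) (x : E d) :
    gradient ((φ + ψ : 𝓓(Λ, ℝ)) : E d → ℝ) x =
      gradient (φ : E d → ℝ) x + gradient (ψ : E d → ℝ) x := by
  have h1 : DifferentiableAt ℝ (φ : E d → ℝ) x := φ.contDiff.differentiable (by simp) x
  have h2 : DifferentiableAt ℝ (ψ : E d → ℝ) x := ψ.contDiff.differentiable (by simp) x
  have h : ((φ + ψ : 𝓓(Λ, ℝ)) : E d → ℝ) = (φ : E d → ℝ) + ψ := rfl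
  rw [h, gradient, gradient, gradient, fderiv_add h1 h2, map_add]

theorem gradient_smul {d : ℕ} {Λ : Opens (E d)} (c : ℝ) (φ : 𝓓(Λ, ℝ)) (x : E d) :
    gradient ((c • φ : 𝓓(Λ, ℝ)) : E d → ℝ) x = c • gradient (φ : E d → ℝ) x := by
  have h1 : DifferentiableAt ℝ (φ : E d → ℝ) x := φ.contDiff.differentiable (by simp) x
  have h : ((c • φ : 𝓓(Λ, ℝ)) : E d → ℝ) = c • (φ : E d → ℝ) := rfl
  rw [h, gradient, gradient, fderiv_const_smul h1]
  simp

/-- The test functions `C_c^∞(Λ)`, sitting in `L²(Λ) × L²(Λ; ℝ^d)` through `φ ↦ (φ, ∇φ)`.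
The norm of the product is `(‖u‖² + ‖∇u‖²)^{1/2}`, the norm of `W^{1,2}(Λ)`. -/
noncomputable def testGraph {d : ℕ} (Λ : Opens (E d)) :
    Submodule ℝ (WithLp 2 (H Λ × HVec Λ)) where
  carrier := {w | ∃ φ : 𝓓(Λ, ℝ), w.fst = (memLp_testFunction φ).toLp _ ∧
    w.snd = (memLp_gradient φ).toLp _}
  add_mem' := by
    rintro a b ⟨φ, h1, h2⟩ ⟨ψ, h3, h4⟩
    refine ⟨φ + ψ, ?_, ?_⟩
    · rw [WithLp.add_fst, h1, h3, ← MemLp.toLp_add]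
      rfl
    · rw [WithLp.add_snd, h2, h4, ← MemLp.toLp_add]
      exact MemLp.toLp_congr _ _ (.of_forall fun x => (gradient_add φ ψ x).symm)
  zero_mem' := by
    have h := gradient_smul (0 : ℝ) (0 : 𝓓(Λ, ℝ))
    simp only [zero_smul] at h
    refine ⟨0, ?_, ?_⟩
    · exact (MemLp.toLp_zero (memLp_testFunction (0 : 𝓓(Λ, ℝ)))).symm
    · rw [WithLp.zero_snd, ← MemLp.toLp_zero (MemLp.zero (p := 2) (μ := leb Λ) (ε := E d))]
      exact MemLp.toLp_congr _ _ (.of_forall fun x => (h x).symm)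
  smul_mem' := by
    rintro c a ⟨φ, h1, h2⟩
    refine ⟨c • φ, ?_, ?_⟩
    · rw [WithLp.smul_fst, h1, ← MemLp.toLp_const_smul]
      rfl
    · rw [WithLp.smul_snd, h2, ← MemLp.toLp_const_smul]
      exact MemLp.toLp_congr _ _ (.of_forall fun x => (gradient_smul c φ x).symm)

/-- `W₀^{1,2}(Λ)`: the closure of `C_c^∞(Λ)` in the norm of `W^{1,2}(Λ)`. An element is the pair of
a function `u ∈ L²(Λ)` and its weak gradient `∇u ∈ L²(Λ; ℝ^d)`; the lemmas `hasWeakGrad` and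
`toH_injective` below show that the second entry is the weak gradient of the first one
and that the first entry determines the element. -/
noncomputable def W0 {d : ℕ} (Λ : Opens (E d)) : Submodule ℝ (WithLp 2 (H Λ × HVec Λ)) :=
  (testGraph Λ).topologicalClosure

/-- The space `V = W₀^{1,2}(Λ)`. -/
abbrev V {d : ℕ} (Λ : Opens (E d)) : Type := W0 Λ

/-- The dual space `V* = W^{-1,2}(Λ)` of `V`: the continuous linear functionals on `V`. -/
abbrev VDual {d : ℕ} (Λ : Opens (E d)) : Type := V Λ →L[ℝ] ℝ

/-- The embedding `V ⊆ H`. -/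
noncomputable def toH {d : ℕ} (Λ : Opens (E d)) : V Λ →L[ℝ] H Λ :=
  (WithLp.fstL 2 ℝ (H Λ) (HVec Λ)).comp (W0 Λ).subtypeL

/-- The gradient `∇ : V → L²(Λ; ℝ^d)`. -/
noncomputable def grad {d : ℕ} (Λ : Opens (E d)) : V Λ →L[ℝ] HVec Λ :=
  (WithLp.sndL 2 ℝ (H Λ) (HVec Λ)).comp (W0 Λ).subtypeL

/-- The partial derivative `D_i : V → L²(Λ)`. -/
noncomputable def D {d : ℕ} (Λ : Opens (E d)) (i : Fin d) : V Λ →L[ℝ] H Λ :=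
  ((EuclideanSpace.proj i : E d →L[ℝ] ℝ).compLpL 2 (leb Λ)).comp (grad Λ)

/-- The norm `‖u‖_V = ‖u‖_{1,2} = (∫_Λ |∇u|² dx)^{1/2}`. For bounded `Λ` it is equivalent to the
norm inherited from `W^{1,2}(Λ)`, so both have the same continuous linear functionals. -/
noncomputable def normV {d : ℕ} {Λ : Opens (E d)} (u : V Λ) : ℝ := ‖grad Λ u‖

/-- The embedding `H ⊆ V*`, `⟨h, φ⟩ = ∫_Λ h φ dx`. -/
noncomputable def toVDual {d : ℕ} (Λ : Opens (E d)) (h : H Λ) : VDual Λ :=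
  (innerSL ℝ h).comp (toH Λ)

/-- The Laplace operator `Δ : V → V*`, `⟨Δu, φ⟩ = -∫_Λ ∇u · ∇φ dx`. -/
noncomputable def laplacian {d : ℕ} (Λ : Opens (E d)) (u : V Λ) : VDual Λ :=
  -(innerSL ℝ (grad Λ u)).comp (grad Λ)

/-- The pointwise product `a h ∈ L²(Λ)` of `a ∈ L^∞(Λ)` and `h ∈ L²(Λ)`. -/
noncomputable def mulL2 {d : ℕ} {Λ : Opens (E d)} (a : E d → ℝ) (ha : MemLp a ∞ (leb Λ))
    (h : H Λ) : H Λ :=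
  MemLp.toLp (fun x => a x * h x) ((Lp.memLp h).mul ha)

/-- `f` is a bounded Lipschitz function on `ℝ`. -/
def BddLip (f : ℝ → ℝ) : Prop :=
  (∃ C : ℝ, ∀ s, |f s| ≤ C) ∧ ∃ L, LipschitzWith L f

theorem BddLip.memLp_comp {d : ℕ} {Λ : Opens (E d)} {f : ℝ → ℝ} (hf : BddLip f) (u : H Λ) :
    MemLp (fun x => f (u x)) ∞ (leb Λ) := by
  obtain ⟨⟨C, hC⟩, L, hL⟩ := hf
  exact memLp_top_of_bound (hL.continuous.comp_aestronglyMeasurable (Lp.aestronglyMeasurable u)) C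
    (.of_forall fun x => hC (u x))

/-- The operator `A(u) = Δu + ∑ i, f_i(u) D_i u`, from `V` to `V*`. -/
noncomputable def A {d : ℕ} (Λ : Opens (E d)) (f : Fin d → ℝ → ℝ) (hf : ∀ i, BddLip (f i))
    (u : V Λ) : VDual Λ :=
  laplacian Λ u + ∑ i, toVDual Λ (mulL2 (fun x => f i (toH Λ u x)) ((hf i).memLp_comp _) (D Λ i u))

/-- The operator `A(u) = Δu + ∑ i, f_i D_i u`, from `V` to `V*`, where the coefficients
`f_i ∈ L^∞(Λ)` do not depend on `u`. -/
noncomputable def ALin {d : ℕ} (Λ : Opens (E d)) (f : Fin d → E d → ℝ)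
    (hf : ∀ i, MemLp (f i) ∞ (leb Λ)) (u : V Λ) : VDual Λ :=
  laplacian Λ u + ∑ i, toVDual Λ (mulL2 (f i) (hf i) (D Λ i u))

theorem exists_inner_fst {d : ℕ} {Λ : Opens (E d)} (φ : 𝓓(Λ, ℝ)) (i : Fin d) :
    ∃ p : H Λ, ∀ u : H Λ,
      ∫ x in (Λ : Set (E d)), u x * gradient (φ : E d → ℝ) x i = inner ℝ p u := by
  have h : MemLp (fun x => gradient (φ : E d → ℝ) x i) 2 (leb Λ) :=
    (EuclideanSpace.proj i : E d →L[ℝ] ℝ).comp_memLp' (memLp_gradient φ)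
  refine ⟨h.toLp _, fun u => ?_⟩
  rw [L2.inner_def]
  refine integral_congr_ae ?_
  filter_upwards [h.coeFn_toLp] with x hx
  simp [hx]

theorem exists_inner_snd {d : ℕ} {Λ : Opens (E d)} (φ : 𝓓(Λ, ℝ)) (i : Fin d) :
    ∃ q : HVec Λ, ∀ g : HVec Λ,
      ∫ x in (Λ : Set (E d)), g x i * φ x = inner ℝ q g := by
  have h : MemLp (fun x => EuclideanSpace.single i (φ x)) 2 (leb Λ) := by
    refine MemLp.of_le (memLp_testFunction φ) ?_ (.of_forall fun x => by simp)
    have : Continuous fun x => (EuclideanSpace.single i (φ x) : E d) := by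
      have h2 : Continuous fun x => φ x • (EuclideanSpace.single i (1 : ℝ) : E d) :=
        φ.continuous.smul continuous_const
      have h3 : ∀ t : ℝ, (EuclideanSpace.single i t : E d) =
          t • (EuclideanSpace.single i (1 : ℝ) : E d) := fun t => by
        ext j
        by_cases hj : j = i <;> simp [hj]
      simpa only [← h3] using h2
    exact this.aestronglyMeasurable
  refine ⟨h.toLp _, fun u => ?_⟩
  rw [L2.inner_def]
  refine integral_congr_ae ?_
  filter_upwards [h.coeFn_toLp] with x hx
  rw [hx, EuclideanSpace.inner_single_left]
  simp [mul_comm]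

theorem gradient_apply {d : ℕ} {Λ : Opens (E d)} (φ : 𝓓(Λ, ℝ)) (x : E d) (i : Fin d) :
    gradient (φ : E d → ℝ) x i =
      fderiv ℝ (φ : E d → ℝ) x (EuclideanSpace.single i (1 : ℝ)) := by
  rw [← toDual_gradient, InnerProductSpace.toDual_apply_apply, EuclideanSpace.inner_single_right]
  simp

theorem integral_by_parts {d : ℕ} {Λ : Opens (E d)} (φ ψ : 𝓓(Λ, ℝ)) (i : Fin d) :
    ∫ x in (Λ : Set (E d)), ψ x * gradient (φ : E d → ℝ) x i =
      -∫ x in (Λ : Set (E d)), gradient (ψ : E d → ℝ) x i * φ x := by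
  have hz : ∀ (χ : 𝓓(Λ, ℝ)) (x : E d), x ∉ (Λ : Set (E d)) → χ x = 0 := fun χ x hx =>
    image_eq_zero_of_notMem_tsupport fun h => hx (χ.tsupport_subset h)
  rw [setIntegral_eq_integral_of_forall_compl_eq_zero (fun x hx => by rw [hz ψ x hx, zero_mul]),
    setIntegral_eq_integral_of_forall_compl_eq_zero (fun x hx => by rw [hz φ x hx, mul_zero])]
  simp only [gradient_apply]
  have c : ∀ χ : 𝓓(Λ, ℝ), Continuous fun x =>
      fderiv ℝ (χ : E d → ℝ) x (EuclideanSpace.single i (1 : ℝ)) := fun χ =>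
    (χ.contDiff.continuous_fderiv (by simp)).clm_apply continuous_const
  apply integral_mul_fderiv_eq_neg_fderiv_mul_of_integrable
  · exact ((c ψ).mul φ.continuous).integrable_of_hasCompactSupport φ.hasCompactSupport.mul_left
  · exact (ψ.continuous.mul (c φ)).integrable_of_hasCompactSupport ψ.hasCompactSupport.mul_right
  · exact (ψ.continuous.mul φ.continuous).integrable_of_hasCompactSupport
      ψ.hasCompactSupport.mul_right
  · exact fun x _ => ψ.contDiff.differentiable (by simp) x
  · exact fun x _ => φ.contDiff.differentiable (by simp) x

/-- The second entry of an element of `W₀^{1,2}(Λ)` is the weak gradient of the first one. -/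
theorem hasWeakGrad {d : ℕ} {Λ : Opens (E d)} (u : V Λ) : HasWeakGrad (toH Λ u) (grad Λ u) := by
  intro φ i
  obtain ⟨p, hp⟩ := exists_inner_fst φ i
  obtain ⟨q, hq⟩ := exists_inner_snd φ i
  rw [hp, hq]
  have hcl : IsClosed {w : WithLp 2 (H Λ × HVec Λ) | inner ℝ p w.fst = -inner ℝ q w.snd} := by
    refine isClosed_eq ?_ ?_
    · exact (innerSL ℝ p).continuous.comp (WithLp.fstL 2 ℝ (H Λ) (HVec Λ)).continuous
    · exact ((innerSL ℝ q).continuous.comp (WithLp.sndL 2 ℝ (H Λ) (HVec Λ)).continuous).neg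
  refine closure_minimal (s := (testGraph Λ : Set (WithLp 2 (H Λ × HVec Λ)))) ?_ hcl u.2
  rintro w ⟨ψ, h1, h2⟩
  change inner ℝ p w.fst = -inner ℝ q w.snd
  rw [← hp, ← hq, h1, h2]
  refine Eq.trans (integral_congr_ae ?_) ((integral_by_parts φ ψ i).trans
    (congrArg Neg.neg (integral_congr_ae ?_)))
  · filter_upwards [(memLp_testFunction ψ).coeFn_toLp] with x hx
    rw [hx]
  · filter_upwards [(memLp_gradient ψ).coeFn_toLp] with x hx
    rw [hx]

/-- The embedding `V ⊆ H` is injective. -/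
theorem toH_injective {d : ℕ} (Λ : Opens (E d)) : Function.Injective (toH Λ) := by
  rw [injective_iff_map_eq_zero]
  intro u hu
  have hg : grad Λ u = 0 := by
    rw [Lp.eq_zero_iff_ae_eq_zero]
    have key : ∀ i, ∀ᵐ x ∂(leb Λ), (grad Λ u) x i = 0 := by
      intro i
      have hm : MemLp (fun x => (grad Λ u) x i) 2 (leb Λ) :=
        (EuclideanSpace.proj i : E d →L[ℝ] ℝ).comp_memLp' (Lp.memLp (grad Λ u))
      rw [ae_restrict_iff' Λ.isOpen.measurableSet]
      refine Λ.isOpen.ae_eq_zero_of_integral_contDiff_smul_eq_zero ?_ ?_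
      · exact (locallyIntegrableOn_of_locallyIntegrable_restrict
          (hm.locallyIntegrable (by norm_num)))
      · intro φ h1 h2 h3
        have h := hasWeakGrad u ⟨φ, h1, h2, h3⟩ i
        rw [hu] at h
        have h0 : ∫ x in (Λ : Set (E d)), (0 : H Λ) x * gradient φ x i = 0 := by
          refine integral_eq_zero_of_ae ?_
          filter_upwards [Lp.coeFn_zero ℝ 2 (leb Λ)] with x hx
          rw [hx]
          simp
        have h4 : ∫ x in (Λ : Set (E d)), (grad Λ u) x i * φ x = 0 := by
          have h5 := h0.symm.trans h
          exact neg_eq_zero.1 h5.symm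
        rw [← setIntegral_eq_integral_of_forall_compl_eq_zero (s := (Λ : Set (E d)))]
        · simpa only [smul_eq_mul, mul_comm] using h4
        · intro x hx
          rw [image_eq_zero_of_notMem_tsupport fun h => hx (h3 h), zero_smul]
    filter_upwards [ae_all_iff.2 key] with x hx
    ext i
    exact hx i
  apply Subtype.ext
  apply (WithLp.equiv 2 (H Λ × HVec Λ)).injective
  exact Prod.ext hu hg

end LocMon

/-!
Write `w = u - v`. In `2⟨A(u) - A(v), w⟩` the Laplacian contributes `-2‖w‖_V²`, and each lower order
term splits as
`f_i(u) D_i u - f_i(v) D_i v = f_i(u) D_i w + (f_i(u) - f_i(v)) D_i v`.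
The first part, tested with `w`, is at most `sup |f_i| ‖w‖_V ‖w‖_H`; for coefficients that do not
depend on `u` there is nothing else. The second part is at most `Lip(f_i) ∫ |D_i v| w²`, hence at most
`Lip(f_i) ‖v‖_V ‖w‖_{L⁴}²`. Young's inequality then absorbs one `‖w‖_V²`, once the Ladyzhenskaya
inequality
`‖w‖_{L⁴}⁴ ≤ C ‖w‖_H^{4-d} ‖w‖_V^d`, `d ≤ 3`,
is known. It explains the exponents of `‖v‖_V`: Young's inequality gives the power `4 / (4 - d)`,
which is `4/3`, `2`, `4`, and `4/3` is replaced by `2`.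

The Ladyzhenskaya inequality is `exists_lintegral_enorm_pow_four_le` for `C¹` functions with compact
support: for `d = 1` it follows from `sup φ² ≤ ∫ |(φ²)'|`, for `d = 2` from the
Gagliardo-Nirenberg-Sobolev inequality for `φ²` in `W^{1,1}`, and for `d = 3` from the Sobolev
inequality `‖φ‖_{L⁶} ≤ C ‖∇φ‖_{L²}` and `∫ φ⁴ ≤ ‖φ‖_{L²} ‖φ³‖_{L²}`. Fatou's lemma carries it over to
the closure `V` of the test functions (`exists_lintegral_toH_pow_four_le`).
-/

namespace LocMon

open MeasureTheory TopologicalSpace Filter Topology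
open scoped ENNReal NNReal ContDiff Distributions

/-! ### The Ladyzhenskaya inequality -/

theorem enorm_le_lintegral_fderiv_of_dim_one {u : E 1 → ℝ} (hu : ContDiff ℝ 1 u)
    (h2u : HasCompactSupport u) (x : E 1) : ‖u x‖ₑ ≤ ∫⁻ y, ‖fderiv ℝ u y‖ₑ := by
  let e : ℝ ≃ₗᵢ[ℝ] E 1 := (OrthonormalBasis.singleton (Fin 1) ℝ).repr
  have he : HasCompactSupport (u ∘ e) := h2u.comp_homeomorph e.toHomeomorph
  have hc : ContDiff ℝ 1 (u ∘ e) := hu.comp e.toContinuousLinearEquiv.contDiff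
  have hderiv : ∀ t, ‖deriv (u ∘ e) t‖ₑ ≤ ‖fderiv ℝ u (e t)‖ₑ := by
    intro t
    have h : HasDerivAt (u ∘ e) (fderiv ℝ u (e t) (e 1)) t :=
      ((hu.differentiable one_ne_zero (e t)).hasFDerivAt.comp_hasDerivAt t
        e.toContinuousLinearEquiv.toContinuousLinearMap.hasDerivAt)
    rw [h.deriv, enorm_le_iff_norm_le]
    simpa using (fderiv ℝ u (e t)).le_opNorm (e 1)
  calc ‖u x‖ₑ = ‖(u ∘ e) (e.symm x)‖ₑ := by simp
    _ ≤ ∫⁻ t in Set.Iic (e.symm x), ‖deriv (u ∘ e) t‖ₑ := he.enorm_le_lintegral_Ici_deriv hc _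
    _ ≤ ∫⁻ t, ‖deriv (u ∘ e) t‖ₑ := setLIntegral_le_lintegral _ _
    _ ≤ ∫⁻ t, ‖fderiv ℝ u (e t)‖ₑ := lintegral_mono hderiv
    _ = ∫⁻ y, ‖fderiv ℝ u y‖ₑ :=
      e.measurePreserving.lintegral_comp (hu.continuous_fderiv one_ne_zero).enorm.measurable

/-- The Cauchy-Schwarz inequality for the norms of two functions, with values in `[0, ∞]`. -/
theorem lintegral_enorm_mul_le {α F G : Type*} [MeasurableSpace α] {μ : Measure α}
    [NormedAddCommGroup F] [NormedAddCommGroup G] {f : α → F} {g : α → G}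
    (hf : AEStronglyMeasurable f μ) (hg : AEStronglyMeasurable g μ) :
    ∫⁻ x, ‖f x‖ₑ * ‖g x‖ₑ ∂μ ≤ eLpNorm f 2 μ * eLpNorm g 2 μ := by
  have h := ENNReal.lintegral_mul_le_Lp_mul_Lq μ Real.HolderConjugate.two_two hf.enorm hg.enorm
  simpa [eLpNorm_eq_lintegral_rpow_enorm_toReal (p := 2) (by simp) (by simp)] using h

theorem lintegral_enorm_pow_eq_eLpNorm_pow {α F : Type*} [MeasurableSpace α] {μ : Measure α}
    [NormedAddCommGroup F] (f : α → F) {n : ℕ} (hn : n ≠ 0) :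
    ∫⁻ x, ‖f x‖ₑ ^ n ∂μ = eLpNorm f n μ ^ n := by
  have := eLpNorm_nnreal_pow_eq_lintegral (μ := μ) (f := f) (p := (n : ℝ≥0)) (by simpa using hn)
  simpa using this.symm

theorem lintegral_enorm_fderiv_sq_le {d : ℕ} {u : E d → ℝ} (hu : ContDiff ℝ 1 u) :
    ∫⁻ x, ‖fderiv ℝ (fun y => u y ^ 2) x‖ₑ ≤
      2 * (eLpNorm u 2 volume * eLpNorm (fderiv ℝ u) 2 volume) := by
  have h : ∀ x, ‖fderiv ℝ (fun y => u y ^ 2) x‖ₑ = 2 * (‖u x‖ₑ * ‖fderiv ℝ u x‖ₑ) := by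
    intro x
    rw [fderiv_fun_pow 2 (hu.differentiable one_ne_zero x), enorm_smul]
    have h2 : ‖(2 : ℝ)‖ₑ = 2 := by simp [enorm_eq_nnnorm]
    simp [enorm_mul, mul_assoc, h2]
  simp only [h]
  rw [lintegral_const_mul' _ _ (by simp)]
  gcongr
  exact lintegral_enorm_mul_le hu.continuous.aestronglyMeasurable
    (hu.continuous_fderiv one_ne_zero).aestronglyMeasurable

/-- The Ladyzhenskaya inequality `‖u‖_{L⁴}⁴ ≤ C ‖u‖_{L²}^{4-d} ‖∇u‖_{L²}^d` in dimension `d ≤ 3`. -/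
theorem exists_lintegral_enorm_pow_four_le {d : ℕ} (h1 : 1 ≤ d) (h3 : d ≤ 3) :
    ∃ C : ℝ≥0, ∀ u : E d → ℝ, ContDiff ℝ 1 u → HasCompactSupport u →
      ∫⁻ x, ‖u x‖ₑ ^ 4 ≤
        C * (eLpNorm u 2 volume ^ (4 - d) * eLpNorm (fderiv ℝ u) 2 volume ^ d) := by
  have hsq : ∀ u : E d → ℝ, ContDiff ℝ 1 u → HasCompactSupport u →
      ContDiff ℝ 1 (fun y => u y ^ 2) ∧ HasCompactSupport (fun y => u y ^ 2) := fun u hu h2u =>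
    ⟨hu.pow 2, h2u.comp_left (g := fun t : ℝ => t ^ 2) (by simp)⟩
  interval_cases d
  -- `d = 1`: bound one factor `u²` of `u⁴` by its supremum
  · refine ⟨2, fun u hu h2u => ?_⟩
    obtain ⟨hc, hs⟩ := hsq u hu h2u
    calc ∫⁻ x, ‖u x‖ₑ ^ 4
        ≤ ∫⁻ x, 2 * (eLpNorm u 2 volume * eLpNorm (fderiv ℝ u) 2 volume) * ‖u x‖ₑ ^ 2 := by
          refine lintegral_mono fun x => ?_
          have := (enorm_le_lintegral_fderiv_of_dim_one hc hs x).trans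
            (lintegral_enorm_fderiv_sq_le hu)
          rw [enorm_pow] at this
          calc ‖u x‖ₑ ^ 4 = ‖u x‖ₑ ^ 2 * ‖u x‖ₑ ^ 2 := by ring
            _ ≤ _ := by gcongr
      _ = 2 * (eLpNorm u 2 volume * eLpNorm (fderiv ℝ u) 2 volume) * eLpNorm u 2 volume ^ 2 := by
          rw [lintegral_const_mul _ (hu.continuous.enorm.measurable.pow_const 2),
            lintegral_enorm_pow_eq_eLpNorm_pow u two_ne_zero]
          rfl
      _ = _ := by push_cast; ring
  -- `d = 2`: the embedding `W^{1,1} ⊆ L²`, applied to `u²`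
  · refine ⟨4 * lintegralPowLePowLIntegralFDerivConst (volume : Measure (E 2)) 2,
      fun u hu h2u => ?_⟩
    obtain ⟨hc, hs⟩ := hsq u hu h2u
    have h := lintegral_pow_le_pow_lintegral_fderiv (volume : Measure (E 2)) hc hs (p := 2)
      (by simpa using Real.HolderConjugate.two_two)
    calc ∫⁻ x, ‖u x‖ₑ ^ 4 = ∫⁻ x, ‖u x ^ 2‖ₑ ^ (2 : ℝ) := by
          refine lintegral_congr fun x => ?_
          rw [enorm_pow, ENNReal.rpow_two]
          ring
      _ ≤ _ := h
      _ ≤ lintegralPowLePowLIntegralFDerivConst (volume : Measure (E 2)) 2 *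
          (2 * (eLpNorm u 2 volume * eLpNorm (fderiv ℝ u) 2 volume)) ^ (2 : ℝ) := by
          gcongr
          exact lintegral_enorm_fderiv_sq_le hu
      _ = _ := by rw [ENNReal.rpow_two]; push_cast; ring
  -- `d = 3`: the embedding `W^{1,2} ⊆ L⁶`
  · refine ⟨SNormLESNormFDerivOfEqConst ℝ (volume : Measure (E 3)) 2 ^ 3, fun u hu h2u => ?_⟩
    have h := eLpNorm_le_eLpNorm_fderiv_of_eq (volume : Measure (E 3)) hu h2u (p := 2) (p' := 6)
      (by norm_num) (by simp) (by norm_num)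
    have hcube : eLpNorm (fun x => u x ^ 3) 2 volume = eLpNorm u 6 volume ^ 3 := by
      have h2 := lintegral_enorm_pow_eq_eLpNorm_pow (μ := volume) (fun x => u x ^ 3) two_ne_zero
      have h6 := lintegral_enorm_pow_eq_eLpNorm_pow (μ := volume) u (n := 6) (by norm_num)
      have : eLpNorm (fun x => u x ^ 3) 2 volume ^ 2 = (eLpNorm u 6 volume ^ 3) ^ 2 := by
        rw [← pow_mul]
        refine h2.symm.trans (Eq.trans (lintegral_congr fun x => ?_) h6)
        rw [enorm_pow, ← pow_mul]
      exact (ENNReal.pow_right_strictMono two_ne_zero).injective this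
    calc ∫⁻ x, ‖u x‖ₑ ^ 4 = ∫⁻ x, ‖u x‖ₑ * ‖u x ^ 3‖ₑ := by
          refine lintegral_congr fun x => ?_
          rw [enorm_pow]
          ring
      _ ≤ eLpNorm u 2 volume * eLpNorm u 6 volume ^ 3 := by
          rw [← hcube]
          exact lintegral_enorm_mul_le hu.continuous.aestronglyMeasurable
            (hu.continuous.pow 3).aestronglyMeasurable
      _ ≤ eLpNorm u 2 volume * (SNormLESNormFDerivOfEqConst ℝ (volume : Measure (E 3)) 2 *
          eLpNorm (fderiv ℝ u) 2 volume) ^ 3 := by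
          gcongr
          exact_mod_cast h
      _ = _ := by push_cast; ring

/-- The Ladyzhenskaya inequality on `V`, by Fatou's lemma along test functions that converge in
`W^{1,2}` and almost everywhere. -/
theorem exists_lintegral_toH_pow_four_le {d : ℕ} (h1 : 1 ≤ d) (h3 : d ≤ 3) (Λ : Opens (E d)) :
    ∃ C : ℝ≥0, ∀ w : V Λ, ∫⁻ x, ‖toH Λ w x‖ₑ ^ 4 ∂(leb Λ) ≤
      C * ENNReal.ofReal (‖toH Λ w‖ ^ (4 - d) * normV w ^ d) := by
  obtain ⟨C, hC⟩ := exists_lintegral_enorm_pow_four_le h1 h3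
  refine ⟨C, fun w => ?_⟩
  have htest : ∀ a ∈ testGraph Λ, ∫⁻ x, ‖a.fst x‖ₑ ^ 4 ∂(leb Λ) ≤
      C * ENNReal.ofReal (‖a.fst‖ ^ (4 - d) * ‖a.snd‖ ^ d) := by
    rintro a ⟨φ, hfst, hsnd⟩
    have hφ : ContDiff ℝ 1 (φ : E d → ℝ) := φ.contDiff.of_le (by simp)
    have hs : Function.support (φ : E d → ℝ) ⊆ (Λ : Set (E d)) :=
      (subset_tsupport _).trans φ.tsupport_subset
    have hs' : Function.support (gradient (φ : E d → ℝ)) ⊆ (Λ : Set (E d)) := by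
      refine fun x hx => φ.tsupport_subset (support_fderiv_subset ℝ fun h0 => hx ?_)
      rw [gradient, h0, map_zero]
    have e1 : ∫⁻ x, ‖a.fst x‖ₑ ^ 4 ∂(leb Λ) = ∫⁻ x in (Λ : Set (E d)), ‖φ x‖ₑ ^ 4 := by
      refine lintegral_congr_ae ?_
      rw [hfst]
      filter_upwards [(memLp_testFunction φ).coeFn_toLp] with x hx
      rw [hx]
    have e2 : eLpNorm (φ : E d → ℝ) 2 volume = ENNReal.ofReal ‖a.fst‖ := by
      rw [hfst, ofReal_norm, Lp.enorm_toLp,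
        eLpNorm_restrict_eq_of_support_subset hs]
    have e3 : eLpNorm (fderiv ℝ (φ : E d → ℝ)) 2 volume = ENNReal.ofReal ‖a.snd‖ := by
      rw [hsnd, ofReal_norm, Lp.enorm_toLp, eLpNorm_restrict_eq_of_support_subset hs']
      refine eLpNorm_congr_norm_ae (.of_forall fun x => ?_)
      rw [gradient, LinearIsometryEquiv.norm_map]
    rw [e1, ENNReal.ofReal_mul (by positivity), ENNReal.ofReal_pow (norm_nonneg _),
      ENNReal.ofReal_pow (norm_nonneg _), ← e2, ← e3]
    exact (setLIntegral_le_lintegral _ _).trans (hC φ hφ φ.hasCompactSupport)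
  obtain ⟨a, ha, hlim⟩ := mem_closure_iff_seq_limit.1 w.2
  have hfst : Tendsto (fun n => (a n).fst) atTop (𝓝 (toH Λ w)) :=
    ((WithLp.fstL 2 ℝ (H Λ) (HVec Λ)).continuous.tendsto _).comp hlim
  have hsnd : Tendsto (fun n => (a n).snd) atTop (𝓝 (grad Λ w)) :=
    ((WithLp.sndL 2 ℝ (H Λ) (HVec Λ)).continuous.tendsto _).comp hlim
  obtain ⟨ns, hns, hae⟩ := (tendstoInMeasure_of_tendsto_Lp hfst).exists_seq_tendsto_ae
  have hbound : Tendsto (fun n => (C : ℝ≥0∞) *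
      ENNReal.ofReal (‖(a (ns n)).fst‖ ^ (4 - d) * ‖(a (ns n)).snd‖ ^ d)) atTop
      (𝓝 (C * ENNReal.ofReal (‖toH Λ w‖ ^ (4 - d) * normV w ^ d))) := by
    refine ENNReal.Tendsto.const_mul ?_ (.inr (by simp))
    exact (ENNReal.tendsto_ofReal (((hfst.norm.pow _).mul (hsnd.norm.pow _)))).comp
      hns.tendsto_atTop
  calc ∫⁻ x, ‖toH Λ w x‖ₑ ^ 4 ∂(leb Λ)
      = ∫⁻ x, liminf (fun n => ‖(a (ns n)).fst x‖ₑ ^ 4) atTop ∂(leb Λ) := by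
        refine lintegral_congr_ae ?_
        filter_upwards [hae] with x hx
        exact (((ENNReal.continuous_pow 4).tendsto _).comp hx.enorm).liminf_eq.symm
    _ ≤ liminf (fun n => ∫⁻ x, ‖(a (ns n)).fst x‖ₑ ^ 4 ∂(leb Λ)) atTop :=
        lintegral_liminf_le' fun n => (Lp.aestronglyMeasurable _).enorm.pow_const 4
    _ ≤ liminf (fun n => (C : ℝ≥0∞) *
          ENNReal.ofReal (‖(a (ns n)).fst‖ ^ (4 - d) * ‖(a (ns n)).snd‖ ^ d)) atTop :=
        liminf_le_liminf (.of_forall fun n => htest _ (ha _))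
    _ = _ := hbound.liminf_eq

/-- The function `w²`, for `w ∈ V`, as an element of `L²(Λ)`, with the Ladyzhenskaya bound
`‖w‖_{L⁴}⁴ ≤ C ‖w‖_H^{4-d} ‖w‖_V^d` for its norm. -/
theorem exists_sq_L2 {d : ℕ} (h1 : 1 ≤ d) (h3 : d ≤ 3) (Λ : Opens (E d)) :
    ∃ C : ℝ, 0 ≤ C ∧ ∀ w : V Λ, ∃ q : H Λ, (∀ᵐ x ∂(leb Λ), q x = toH Λ w x ^ 2) ∧
      ‖q‖ ^ 2 ≤ C * (‖toH Λ w‖ ^ (4 - d) * normV w ^ d) := by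
  obtain ⟨C, hC⟩ := exists_lintegral_toH_pow_four_le h1 h3 Λ
  refine ⟨C, C.coe_nonneg, fun w => ?_⟩
  have hnn : 0 ≤ ‖toH Λ w‖ ^ (4 - d) * normV w ^ d :=
    mul_nonneg (by positivity) (pow_nonneg (norm_nonneg _) _)
  have hle : eLpNorm (fun x => toH Λ w x ^ 2) 2 (leb Λ) ^ 2 ≤
      ENNReal.ofReal (C * (‖toH Λ w‖ ^ (4 - d) * normV w ^ d)) := by
    rw [ENNReal.ofReal_mul C.coe_nonneg, ENNReal.ofReal_coe_nnreal]
    refine le_trans (le_of_eq ?_) (hC w)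
    refine (lintegral_enorm_pow_eq_eLpNorm_pow (fun x => toH Λ w x ^ 2) two_ne_zero).symm.trans
      (lintegral_congr fun x => ?_)
    rw [enorm_pow, ← pow_mul]
  have hmem : MemLp (fun x => toH Λ w x ^ 2) 2 (leb Λ) := by
    refine ⟨(Lp.aestronglyMeasurable _).pow 2, ?_⟩
    by_contra h
    rw [not_lt_top_iff.1 h, ENNReal.top_pow two_ne_zero] at hle
    exact ENNReal.ofReal_ne_top (top_le_iff.1 hle)
  refine ⟨hmem.toLp _, hmem.coeFn_toLp, ?_⟩
  rw [← ENNReal.ofReal_le_ofReal_iff (mul_nonneg C.coe_nonneg hnn), ENNReal.ofReal_pow (norm_nonneg _),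
    ofReal_norm, Lp.enorm_toLp]
  exact hle

/-! ### Multiplication operators and the lower order terms -/

theorem mulL2_coeFn {d : ℕ} {Λ : Opens (E d)} {a : E d → ℝ} (ha : MemLp a ∞ (leb Λ)) (h : H Λ) :
    ∀ᵐ x ∂(leb Λ), mulL2 a ha h x = a x * h x :=
  MemLp.coeFn_toLp _

theorem norm_mulL2_le {d : ℕ} {Λ : Opens (E d)} {a : E d → ℝ} (ha : MemLp a ∞ (leb Λ)) {M : ℝ}
    (hM : ∀ᵐ x ∂(leb Λ), |a x| ≤ M) (h : H Λ) : ‖mulL2 a ha h‖ ≤ M * ‖h‖ := by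
  refine Lp.norm_le_mul_norm_of_ae_le_mul ?_
  filter_upwards [mulL2_coeFn ha h, hM] with x hx hMx
  rw [hx, norm_mul, Real.norm_eq_abs (a x)]
  gcongr

theorem mulL2_add {d : ℕ} {Λ : Opens (E d)} {a : E d → ℝ} (ha : MemLp a ∞ (leb Λ)) (h k : H Λ) :
    mulL2 a ha (h + k) = mulL2 a ha h + mulL2 a ha k := by
  refine Lp.ext ?_
  filter_upwards [mulL2_coeFn ha (h + k), mulL2_coeFn ha h, mulL2_coeFn ha k, Lp.coeFn_add h k,
    Lp.coeFn_add (mulL2 a ha h) (mulL2 a ha k)] with x h1 h2 h3 h4 h5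
  rw [h1, h5, Pi.add_apply, h2, h3, h4, Pi.add_apply, mul_add]

theorem mulL2_sub {d : ℕ} {Λ : Opens (E d)} {a : E d → ℝ} (ha : MemLp a ∞ (leb Λ)) (h k : H Λ) :
    mulL2 a ha (h - k) = mulL2 a ha h - mulL2 a ha k := by
  rw [eq_sub_iff_add_eq, ← mulL2_add, sub_add_cancel]

/-- If `|a - b| ≤ L |w|` and `q = w²`, then `∫ (a - b) h w ≤ L ∫ |h| w² ≤ L ‖h‖ ‖q‖`. -/
theorem inner_mulL2_sub_mulL2_le {d : ℕ} {Λ : Opens (E d)} {a b : E d → ℝ}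
    (ha : MemLp a ∞ (leb Λ)) (hb : MemLp b ∞ (leb Λ)) {L : ℝ} (hL : 0 ≤ L) {w q : H Λ}
    (hab : ∀ᵐ x ∂(leb Λ), |a x - b x| ≤ L * |w x|) (hq : ∀ᵐ x ∂(leb Λ), q x = w x ^ 2)
    (h : H Λ) :
    inner ℝ (mulL2 a ha h - mulL2 b hb h) w ≤ L * (‖h‖ * ‖q‖) := by
  have key : inner ℝ (mulL2 a ha h - mulL2 b hb h) w ≤ inner ℝ (L • |h|) q := by
    rw [L2.inner_def, L2.inner_def]
    refine integral_mono_ae (L2.integrable_inner _ _) (L2.integrable_inner _ _) ?_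
    filter_upwards [hab, hq, mulL2_coeFn ha h, mulL2_coeFn hb h,
      Lp.coeFn_sub (mulL2 a ha h) (mulL2 b hb h), Lp.coeFn_smul L |h|, Lp.coeFn_abs h]
      with x h1 h2 h3 h4 h5 h6 h7
    simp only [h5, h6, Pi.sub_apply, Pi.smul_apply, h3, h4, h2, h7, smul_eq_mul,
      RCLike.inner_apply, conj_trivial]
    calc w x * (a x * h x - b x * h x) ≤ |w x * (a x * h x - b x * h x)| := le_abs_self _
      _ = |w x| * |h x| * |a x - b x| := by rw [← sub_mul, abs_mul, abs_mul]; ring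
      _ ≤ |w x| * |h x| * (L * |w x|) := by gcongr
      _ = |w x| ^ 2 * (L * |h x|) := by ring
      _ = w x ^ 2 * (L * |h x|) := by rw [sq_abs]
  refine key.trans ?_
  rw [real_inner_smul_left]
  refine mul_le_mul_of_nonneg_left ?_ hL
  exact (real_inner_le_norm |h| q).trans_eq (by rw [norm_abs_eq_norm])

theorem norm_D_le {d : ℕ} {Λ : Opens (E d)} (i : Fin d) (u : V Λ) : ‖D Λ i u‖ ≤ normV u := by
  refine Lp.norm_le_norm_of_ae_le ?_
  filter_upwards [ContinuousLinearMap.coeFn_compLp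
    (EuclideanSpace.proj i : E d →L[ℝ] ℝ) (grad Λ u)] with x hx
  exact (congrArg norm hx).trans_le (PiLp.norm_apply_le _ i)

/-- The pairing `⟨A(u) - A(v), w⟩` at `w = u - v`, for an operator `Δ + B` of lower order part
`B u = ∑ i, b i u`. -/
theorem laplacian_sub_apply {d : ℕ} {Λ : Opens (E d)} (b : Fin d → V Λ → H Λ) (u v : V Λ) :
    ((laplacian Λ u + ∑ i, toVDual Λ (b i u)) - (laplacian Λ v + ∑ i, toVDual Λ (b i v))) (u - v) =
      -normV (u - v) ^ 2 + ∑ i, inner ℝ (b i u - b i v) (toH Λ (u - v)) := by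
  have hlap : laplacian Λ u (u - v) - laplacian Λ v (u - v) = -normV (u - v) ^ 2 := by
    have : normV (u - v) ^ 2 =
        inner ℝ (grad Λ u) (grad Λ (u - v)) - inner ℝ (grad Λ v) (grad Λ (u - v)) := by
      rw [← inner_sub_left, ← map_sub, real_inner_self_eq_norm_sq]
      rfl
    rw [this]
    simp only [laplacian, neg_apply, ContinuousLinearMap.comp_apply,
      innerSL_apply_apply]
    ring
  rw [← hlap]
  simp only [sub_apply, add_apply,
    sum_apply, inner_sub_left, Finset.sum_sub_distrib, toVDual,
    ContinuousLinearMap.comp_apply, innerSL_apply_apply]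
  ring

/-! ### Young's inequality -/

/-- Young's inequality in dimension `1` and `2`, for `n = ‖w‖_H`, `b = ‖w‖_V`, `g = ‖v‖_V` and
`N = ‖w²‖_H`. -/
theorem exists_young_of_le_two {d : ℕ} (h1 : 1 ≤ d) (h2 : d ≤ 2) {C L : ℝ} (hC : 0 ≤ C) :
    ∃ K : ℝ, 0 ≤ K ∧ ∀ n b g N : ℝ, 0 ≤ n → 0 ≤ b → 0 ≤ g →
      N ^ 2 ≤ C * (n ^ (4 - d) * b ^ d) →
      2 * (L * (g * N)) ≤ b ^ 2 / 2 + K * (1 + g ^ 2) * n ^ 2 := by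
  set X := 4 * L ^ 2 * C with hX
  have hX0 : 0 ≤ X := by positivity
  refine ⟨1 + X, by positivity, fun n b g N hn hb hg hN => ?_⟩
  refine le_of_abs_le (abs_le_of_sq_le_sq ?_ (by positivity))
  have hsq : (2 * (L * (g * N))) ^ 2 ≤ X * g ^ 2 * (n ^ (4 - d) * b ^ d) := by
    calc (2 * (L * (g * N))) ^ 2 = 4 * L ^ 2 * g ^ 2 * N ^ 2 := by ring
      _ ≤ 4 * L ^ 2 * g ^ 2 * (C * (n ^ (4 - d) * b ^ d)) := by gcongr
      _ = _ := by rw [hX]; ring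
  refine hsq.trans ?_
  have hlow : (1 + X) * (g ^ 2 * n ^ 2) * (b ^ 2 + n ^ 2) ≤
      (b ^ 2 / 2 + (1 + X) * (1 + g ^ 2) * n ^ 2) ^ 2 := by
    have : (b ^ 2 / 2 + (1 + X) * (1 + g ^ 2) * n ^ 2) ^ 2 =
        (1 + X) * (g ^ 2 * n ^ 2) * (b ^ 2 + n ^ 2) + (b ^ 2 / 2) ^ 2 + (1 + X) * b ^ 2 * n ^ 2 +
        ((1 + X) ^ 2 * (1 + g ^ 4) + (1 + X) * g ^ 2 * (1 + 2 * X)) * n ^ 4 := by ring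
    rw [this]
    have : 0 ≤ (b ^ 2 / 2) ^ 2 + (1 + X) * b ^ 2 * n ^ 2 +
        ((1 + X) ^ 2 * (1 + g ^ 4) + (1 + X) * g ^ 2 * (1 + 2 * X)) * n ^ 4 := by positivity
    linarith
  refine le_trans ?_ hlow
  have hmain : n ^ (4 - d) * b ^ d ≤ n ^ 2 * (b ^ 2 + n ^ 2) := by
    interval_cases d
    · have : n * b ≤ b ^ 2 + n ^ 2 := by nlinarith [sq_nonneg (n - b)]
      calc n ^ (4 - 1) * b ^ 1 = n ^ 2 * (n * b) := by norm_num; ring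
        _ ≤ _ := by gcongr
    · norm_num
      nlinarith [sq_nonneg (n ^ 2)]
  calc X * g ^ 2 * (n ^ (4 - d) * b ^ d) ≤ (1 + X) * g ^ 2 * (n ^ 2 * (b ^ 2 + n ^ 2)) := by
        gcongr
        linarith
    _ = _ := by ring

/-- Young's inequality in dimension `3`, for `n = ‖w‖_H`, `b = ‖w‖_V`, `g = ‖v‖_V` and
`N = ‖w²‖_H`. -/
theorem exists_young_of_eq_three {d : ℕ} (hd : d = 3) {C L : ℝ} (hC : 0 ≤ C) :
    ∃ K : ℝ, 0 ≤ K ∧ ∀ n b g N : ℝ, 0 ≤ n → 0 ≤ b → 0 ≤ g →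
      N ^ 2 ≤ C * (n ^ (4 - d) * b ^ d) →
      2 * (L * (g * N)) ≤ b ^ 2 / 2 + K * (1 + g ^ 4) * n ^ 2 := by
  subst hd
  set X := 4 * L ^ 2 * C with hX
  have hX0 : 0 ≤ X := by positivity
  refine ⟨X ^ 2, by positivity, fun n b g N hn hb hg hN => ?_⟩
  refine le_of_abs_le (abs_le_of_sq_le_sq ?_ (by positivity))
  calc (2 * (L * (g * N))) ^ 2 = 4 * L ^ 2 * g ^ 2 * N ^ 2 := by ring
    _ ≤ 4 * L ^ 2 * g ^ 2 * (C * (n ^ (4 - 3) * b ^ 3)) := by gcongr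
    _ = b ^ 2 * (2 * (b / 2) * (X * g ^ 2 * n)) := by rw [hX]; ring
    _ ≤ b ^ 2 * ((b / 2) ^ 2 + (X * g ^ 2 * n) ^ 2) := by gcongr; exact two_mul_le_add_sq _ _
    _ = (b ^ 2 / 2) ^ 2 + 2 * (b ^ 2 / 2) * (X ^ 2 * g ^ 4 * n ^ 2) := by ring
    _ ≤ (b ^ 2 / 2) ^ 2 + 2 * (b ^ 2 / 2) * (X ^ 2 * (1 + g ^ 4) * n ^ 2) +
        (X ^ 2 * (1 + g ^ 4) * n ^ 2) ^ 2 := by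
      have : X ^ 2 * g ^ 4 * n ^ 2 ≤ X ^ 2 * (1 + g ^ 4) * n ^ 2 := by gcongr; linarith
      have h2 := mul_le_mul_of_nonneg_left this (by positivity : 0 ≤ 2 * (b ^ 2 / 2))
      have := sq_nonneg (X ^ 2 * (1 + g ^ 4) * n ^ 2)
      linarith
    _ = _ := by ring

/-! ### Monotonicity of the operators -/

/-- Local monotonicity of `A`, with the power `‖v‖_V^p` that Young's inequality gives for
`2 L ‖v‖_V ‖w²‖_H` under the Ladyzhenskaya bound on `‖w²‖_H`. -/
theorem exists_locally_monotone {d : ℕ} (h1 : 1 ≤ d) (h3 : d ≤ 3) (Λ : Opens (E d)) (p : ℕ)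
    (young : ∀ {C L : ℝ}, 0 ≤ C → ∃ K : ℝ, 0 ≤ K ∧ ∀ n b g N : ℝ, 0 ≤ n → 0 ≤ b → 0 ≤ g →
      N ^ 2 ≤ C * (n ^ (4 - d) * b ^ d) →
      2 * (L * (g * N)) ≤ b ^ 2 / 2 + K * (1 + g ^ p) * n ^ 2)
    (f : Fin d → ℝ → ℝ) (hf : ∀ i, BddLip (f i)) :
    ∃ K : ℝ, ∀ u v : V Λ, 2 * (A Λ f hf u - A Λ f hf v) (u - v) ≤
      -normV (u - v) ^ 2 + (K + K * normV v ^ p) * ‖toH Λ (u - v)‖ ^ 2 := by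
  choose M hM using fun i => (hf i).1
  choose L hL using fun i => (hf i).2
  obtain ⟨C, hC, hsq⟩ := exists_sq_L2 h1 h3 Λ
  obtain ⟨K, hK, hyoung⟩ := young (C := C) (L := ∑ i, (L i : ℝ)) hC
  have hM0 : ∀ i, 0 ≤ M i := fun i => (abs_nonneg _).trans (hM i 0)
  refine ⟨2 * (∑ i, M i) ^ 2 + K, fun u v => ?_⟩
  obtain ⟨q, hq, hqle⟩ := hsq (u - v)
  have hterm : ∀ i, inner ℝ (mulL2 (fun x => f i (toH Λ u x)) ((hf i).memLp_comp _) (D Λ i u) -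
      mulL2 (fun x => f i (toH Λ v x)) ((hf i).memLp_comp _) (D Λ i v)) (toH Λ (u - v)) ≤
      M i * (normV (u - v) * ‖toH Λ (u - v)‖) + L i * (normV v * ‖q‖) := by
    intro i
    rw [← sub_add_sub_cancel _ (mulL2 (fun x => f i (toH Λ u x)) ((hf i).memLp_comp _) (D Λ i v)),
      ← mulL2_sub, ← map_sub, inner_add_left]
    refine add_le_add ?_ ?_
    · calc _ ≤ _ := real_inner_le_norm _ _
        _ ≤ M i * ‖D Λ i (u - v)‖ * ‖toH Λ (u - v)‖ := by
          gcongr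
          exact norm_mulL2_le _ (.of_forall fun x => hM i _) _
        _ ≤ M i * normV (u - v) * ‖toH Λ (u - v)‖ := by
          gcongr
          · exact hM0 i
          · exact norm_D_le i _
        _ = _ := by ring
    · refine (inner_mulL2_sub_mulL2_le _ _ (L i).coe_nonneg ?_ hq _).trans ?_
      · filter_upwards [Lp.coeFn_sub (toH Λ u) (toH Λ v)] with x hx
        rw [map_sub, hx]
        exact (hL i).dist_le_mul _ _
      · gcongr
        exact norm_D_le i v
  have hA : (A Λ f hf u - A Λ f hf v) (u - v) = _ := laplacian_sub_apply
    (fun i u => mulL2 (fun x => f i (toH Λ u x)) ((hf i).memLp_comp _) (D Λ i u)) u v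
  have hsum := Finset.sum_le_sum fun i (_ : i ∈ Finset.univ) => hterm i
  rw [Finset.sum_add_distrib, ← Finset.sum_mul, ← Finset.sum_mul] at hsum
  have hY := hyoung ‖toH Λ (u - v)‖ (normV (u - v)) (normV v) ‖q‖ (norm_nonneg _) (norm_nonneg _)
    (norm_nonneg _) hqle
  have hg : 0 ≤ (∑ i, M i) ^ 2 * normV v ^ p * ‖toH Λ (u - v)‖ ^ 2 :=
    mul_nonneg (mul_nonneg (sq_nonneg _) (pow_nonneg (norm_nonneg _) _)) (sq_nonneg _)
  rw [hA]
  -- `2 M ‖w‖_V ‖w‖_H ≤ ‖w‖_V² / 2 + 2 M² ‖w‖_H²`; the other half of `‖w‖_V²` is spent in `hY`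
  nlinarith [sq_nonneg (normV (u - v) - 2 * (∑ i, M i) * ‖toH Λ (u - v)‖)]

theorem exists_monotone_ALin {d : ℕ} (Λ : Opens (E d)) (f : Fin d → E d → ℝ)
    (hf : ∀ i, MemLp (f i) ∞ (leb Λ)) :
    ∃ K : ℝ, ∀ u v : V Λ, 2 * (ALin Λ f hf u - ALin Λ f hf v) (u - v) ≤
      -normV (u - v) ^ 2 + K * ‖toH Λ (u - v)‖ ^ 2 := by
  have hbdd : ∀ i, ∃ M : ℝ, 0 ≤ M ∧ ∀ᵐ x ∂(leb Λ), |f i x| ≤ M := fun i => by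
    refine ⟨(eLpNorm (f i) ∞ (leb Λ)).toReal, ENNReal.toReal_nonneg, ?_⟩
    filter_upwards [ae_le_eLpNormEssSup (f := f i) (μ := leb Λ)] with x hx
    rw [← eLpNorm_exponent_top] at hx
    simpa using ENNReal.toReal_mono (hf i).eLpNorm_ne_top hx
  choose M hM0 hM using hbdd
  refine ⟨(∑ i, M i) ^ 2, fun u v => ?_⟩
  have hterm : ∀ i, inner ℝ (mulL2 (f i) (hf i) (D Λ i u) - mulL2 (f i) (hf i) (D Λ i v))
      (toH Λ (u - v)) ≤ M i * (normV (u - v) * ‖toH Λ (u - v)‖) := by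
    intro i
    rw [← mulL2_sub, ← map_sub]
    calc _ ≤ _ := real_inner_le_norm _ _
      _ ≤ M i * ‖D Λ i (u - v)‖ * ‖toH Λ (u - v)‖ := by
        gcongr
        exact norm_mulL2_le _ (hM i) _
      _ ≤ M i * normV (u - v) * ‖toH Λ (u - v)‖ := by
        gcongr
        · exact hM0 i
        · exact norm_D_le i _
      _ = _ := by ring
  have hA : (ALin Λ f hf u - ALin Λ f hf v) (u - v) = _ :=
    laplacian_sub_apply (fun i u => mulL2 (f i) (hf i) (D Λ i u)) u v
  have hsum := Finset.sum_le_sum fun i (_ : i ∈ Finset.univ) => hterm i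
  rw [← Finset.sum_mul] at hsum
  rw [hA]
  nlinarith [sq_nonneg (normV (u - v) - (∑ i, M i) * ‖toH Λ (u - v)‖)]

end LocMon

theorem lemma3p1 {d : ℕ} (hd : 1 ≤ d) (Λ : TopologicalSpace.Opens (LocMon.E d))
    (hΛ : Bornology.IsBounded (Λ : Set (LocMon.E d))) :
    (d < 3 → ∀ (f : Fin d → ℝ → ℝ) (hf : ∀ i, LocMon.BddLip (f i)), ∃ K : ℝ,
      ∀ u v : LocMon.V Λ,
        2 * (LocMon.A Λ f hf u - LocMon.A Λ f hf v) (u - v) ≤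
          -LocMon.normV (u - v) ^ 2 +
            (K + K * LocMon.normV v ^ 2) * ‖LocMon.toH Λ (u - v)‖ ^ 2) ∧
    (d = 3 → ∀ (f : Fin d → ℝ → ℝ) (hf : ∀ i, LocMon.BddLip (f i)), ∃ K : ℝ,
      ∀ u v : LocMon.V Λ,
        2 * (LocMon.A Λ f hf u - LocMon.A Λ f hf v) (u - v) ≤
          -LocMon.normV (u - v) ^ 2 +
            (K + K * LocMon.normV v ^ 4) * ‖LocMon.toH Λ (u - v)‖ ^ 2) ∧
    (∀ (f : Fin d → LocMon.E d → ℝ) (hf : ∀ i, MeasureTheory.MemLp (f i) ⊤ (LocMon.leb Λ)),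
      ∃ K : ℝ, ∀ u v : LocMon.V Λ,
        2 * (LocMon.ALin Λ f hf u - LocMon.ALin Λ f hf v) (u - v) ≤
          -LocMon.normV (u - v) ^ 2 + K * ‖LocMon.toH Λ (u - v)‖ ^ 2) := by
  refine ⟨fun h f hf => ?_, fun h f hf => ?_, fun f hf => LocMon.exists_monotone_ALin Λ f hf⟩
  · exact LocMon.exists_locally_monotone hd (by omega) Λ 2
      (fun hC => LocMon.exists_young_of_le_two hd (by omega) hC) f hf
  · exact LocMon.exists_locally_monotone hd h.le Λ 4
      (fun hC => LocMon.exists_young_of_eq_three h hC) f hf
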